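/- Let $n\ge 1$, $0<p\le 1$, and let $Z\in\mathbb R^{n\times n}$ be a fixed matrix. Let $\Omega\subseteq\{1,\dots,n\}^2$ be a random set that contains each index $(i,j)$ with probability $p$, independently of all other indices. Define the matrix $\mathcal R_\Omega Z$ by $(\mathcal R_\Omega Z)_{ij}=\frac1p Z_{ij}$ if $(i,j)\in\Omega$ and $(\mathcal R_\Omega Z)_{ij}=0$ otherwise, and let $\mathcal I$ be the identity map on matrices. Write $\|\cdot\|$ for the spectral norm, $$\|Z\|_\infty=\max_{i,j}|Z_{ij}|,\qquad \|Z\|_{\infty,2}=\max\Big\{\max_i\sqrt{\textstyle\sum_b Z_{ib}^2},\ \max_j\sqrt{\textstyle\sum_a Z_{aj}^2}\Big\}.$$ Then the following bound holds with high probability: for every $c_2>0$ there are constants $c>1$ and $c_1>0$, depending only on $c_2$ (in particular not on $n$, $p$ or $Z$), such that with probability at least $1-c_1n^{-c_2}$ $$\|(\mathcal R_\Omega-\mathcal I)Z\|\le c\left(\frac{\log n}{p}\|Z\|_\infty+\sqrt{\frac{\log n}{p}}\,\|Z\|_{\infty,2}\right).$$ -/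

import Mathlib

open MeasureTheory ProbabilityTheory

noncomputable section

namespace MatrixSampling

/-- The matrix `ℓ_∞` norm: the largest absolute value of an entry. -/
def normInf {n : ℕ} (Z : Matrix (Fin n) (Fin n) ℝ) : ℝ :=
  ⨆ ij : Fin n × Fin n, |Z ij.1 ij.2|

/-- The matrix `ℓ_{∞,2}` norm: the largest Euclidean norm of a row or column. -/
def normInfTwo {n : ℕ} (Z : Matrix (Fin n) (Fin n) ℝ) : ℝ :=
  max (⨆ i : Fin n, √(∑ b, Z i b ^ 2)) (⨆ j : Fin n, √(∑ a, Z a j ^ 2))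

/-- The spectral norm: the operator norm with respect to the Euclidean norm on `ℝⁿ`. -/
def specNorm {n : ℕ} (Z : Matrix (Fin n) (Fin n) ℝ) : ℝ :=
  ‖Matrix.toEuclideanCLM (n := Fin n) (𝕜 := ℝ) Z‖

open Classical in
/-- `P_S Z` keeps the entries of `Z` with index in `S` and sets the others to zero. -/
def projOn {n : ℕ} (S : Set (Fin n × Fin n)) (Z : Matrix (Fin n) (Fin n) ℝ) :
    Matrix (Fin n) (Fin n) ℝ :=
  Matrix.of fun i j => if (i, j) ∈ S then Z i j else 0

/-- `R_S Z = p⁻¹ P_S Z`. -/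
def rescaledProjOn {n : ℕ} (p : ℝ) (S : Set (Fin n × Fin n)) (Z : Matrix (Fin n) (Fin n) ℝ) :
    Matrix (Fin n) (Fin n) ℝ :=
  (1 / p) • projOn S Z

/-- The random index set `S` follows the Bernoulli(`p`) model: each index belongs to `S` with
probability `p`, independently of all the others. -/
structure IsBernoulliSampling {E : Type*} [MeasurableSpace E] (P : Measure E) {n : ℕ} (p : ℝ)
    (S : E → Set (Fin n × Fin n)) : Prop where
  measurableSet_mem : ∀ ij, MeasurableSet {ω | ij ∈ S ω}
  prob_mem : ∀ ij, P.real {ω | ij ∈ S ω} = p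
  indep : iIndepSet (fun ij => {ω | ij ∈ S ω}) P

end MatrixSampling

end

/-! This is a matrix Bernstein argument by exponential trace moments. The error is a sum of
independent single-entry matrices; `dilation` makes the summands `ξ_k A_k` symmetric.

Peeling off factors by Golden–Thompson (`trace_exp_add_le`) usually costs a sum of norms of
variances in place of the norm of their sum. Compensation avoids this: with `g = θ²/p` and `B_k = θ
ξ_k A_k - g A_k²`, the mean of `exp B_k` is at most the identity (`bernoulli_exp_moment_le`, lifted
by `trace_mul_exp_add_le`), so each peeling step is free (`integral_trace_exp_add_sum_le`). What
remains is `tr exp (g ∑ A_k²)`. This matrix is diagonal, its entries being `g` times the squared row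
and column norms of `Z`, so the trace is at most `2n exp (g ‖Z‖²_{∞,2})`. Markov's inequality and a
choice of `θ` finish the proof. -/

namespace MatrixSampling

open Filter Topology

/-! ### Lie product formula in a Banach algebra -/

section LieProduct

theorem norm_pow_sub_pow_le {𝔸 : Type*} [NormedRing 𝔸] [NormOneClass 𝔸] {x y : 𝔸} {r : ℝ}
    (hx : ‖x‖ ≤ r) (hy : ‖y‖ ≤ r) (n : ℕ) : ‖x ^ (n + 1) - y ^ (n + 1)‖ ≤ (n + 1) * ‖x - y‖ * r ^ n := by
  have hr : 0 ≤ r := (norm_nonneg x).trans hx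
  induction n with
  | zero => simp
  | succ n ih =>
    have e : x ^ (n + 1 + 1) - y ^ (n + 1 + 1)
        = (x ^ (n + 1) - y ^ (n + 1)) * x + y ^ (n + 1) * (x - y) := by
      rw [pow_succ x (n + 1), pow_succ y (n + 1)]; noncomm_ring
    rw [e]
    calc _ ≤ ‖x ^ (n + 1) - y ^ (n + 1)‖ * ‖x‖ + ‖y ^ (n + 1)‖ * ‖x - y‖ :=
          (norm_add_le _ _).trans (add_le_add (norm_mul_le _ _) (norm_mul_le _ _))
      _ ≤ ((n + 1) * ‖x - y‖ * r ^ n) * r + r ^ (n + 1) * ‖x - y‖ := by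
          gcongr
          exact (norm_pow_le _ _).trans (by gcongr)
      _ = _ := by push_cast; ring

variable {𝔸 : Type*} [NormedRing 𝔸] [NormedAlgebra ℝ 𝔸] [NormOneClass 𝔸] [CompleteSpace 𝔸]

theorem norm_exp_le_exp_norm (x : 𝔸) : ‖NormedSpace.exp x‖ ≤ Real.exp ‖x‖ := by
  have hs : HasSum (fun n : ℕ => ((n.factorial : ℝ)⁻¹) • ‖x‖ ^ n) (Real.exp ‖x‖) := by
    rw [Real.exp_eq_exp_ℝ]
    exact NormedSpace.exp_series_hasSum_exp' (𝕂 := ℝ) ‖x‖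
  have hx := NormedSpace.exp_series_hasSum_exp' (𝕂 := ℝ) x
  rw [← hx.tsum_eq]
  refine tsum_of_norm_bounded hs fun n => ?_
  rw [norm_smul, Real.norm_of_nonneg (by positivity), smul_eq_mul]
  gcongr
  exact norm_pow_le x n

/-- The **Lie product formula**. -/
theorem tendsto_exp_mul_exp_pow (a b : 𝔸) :
    Tendsto (fun n : ℕ => (NormedSpace.exp (((n : ℝ) + 1)⁻¹ • a) *
      NormedSpace.exp (((n : ℝ) + 1)⁻¹ • b)) ^ (n + 1)) atTop (𝓝 (NormedSpace.exp (a + b))) := by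
  set f : ℝ → 𝔸 := fun t => NormedSpace.exp (t • a) * NormedSpace.exp (t • b)
    - NormedSpace.exp (t • (a + b)) with hf
  -- The two exponential curves agree to first order at `0`, so `f t = o(t)`; telescoping `n + 1`
  -- factors then still leaves an error tending to `0`.
  have hd : HasDerivAt f 0 0 := by
    have h (c : 𝔸) : HasDerivAt (fun t : ℝ => NormedSpace.exp (t • c)) c 0 := by
      simpa using hasDerivAt_exp_smul_const (𝕂 := ℝ) c (0 : ℝ)
    have := ((h a).mul (h b)).sub (h (a + b))
    exact (this.congr_deriv (by simp)).congr_of_eventuallyEq (Eventually.of_forall fun t => rfl)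
  have hs : Tendsto (fun n : ℕ => ((n : ℝ) + 1)⁻¹) atTop (𝓝[≠] 0) := by
    refine tendsto_nhdsWithin_iff.2 ⟨?_, Eventually.of_forall fun n => ?_⟩
    · simpa [one_div] using tendsto_one_div_add_atTop_nhds_zero_nat (𝕜 := ℝ)
    · simp only [Set.mem_compl_iff, Set.mem_singleton_iff]; positivity
  have hl : Tendsto (fun n : ℕ => ((n : ℝ) + 1) * ‖f (((n : ℝ) + 1)⁻¹)‖) atTop (𝓝 0) := by
    have := ((hasDerivAt_iff_tendsto_slope.1 hd).comp hs).norm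
    simp only [norm_zero] at this
    refine this.congr fun n => ?_
    have h0 : f 0 = 0 := by simp [hf]
    have hn : (0 : ℝ) < (n : ℝ) + 1 := by positivity
    simp [slope, h0, norm_smul, abs_of_pos hn]
  rw [tendsto_iff_norm_sub_tendsto_zero]
  have hl' := hl.mul_const (Real.exp (‖a‖ + ‖b‖))
  rw [zero_mul] at hl'
  refine squeeze_zero (fun _ => norm_nonneg _) (fun n => ?_) hl'
  have hn : (0 : ℝ) < (n : ℝ) + 1 := by positivity
  set s : ℝ := ((n : ℝ) + 1)⁻¹ with hsdef
  have hs0 : 0 < s := inv_pos.2 hn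
  have hns (c : 𝔸) : ‖s • c‖ = s * ‖c‖ := by rw [norm_smul, Real.norm_of_nonneg hs0.le]
  have hx : ‖NormedSpace.exp (s • a) * NormedSpace.exp (s • b)‖
      ≤ Real.exp (s * (‖a‖ + ‖b‖)) := by
    refine (norm_mul_le _ _).trans ?_
    rw [mul_add, Real.exp_add, ← hns, ← hns]
    gcongr <;> exact norm_exp_le_exp_norm _
  have hy : ‖NormedSpace.exp (s • (a + b))‖ ≤ Real.exp (s * (‖a‖ + ‖b‖)) := by
    refine (norm_exp_le_exp_norm _).trans (Real.exp_le_exp.2 ?_)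
    rw [hns]
    gcongr
    exact norm_add_le _ _
  have he : NormedSpace.exp (a + b) = NormedSpace.exp (s • (a + b)) ^ (n + 1) := by
    let _ : NormedAlgebra ℚ 𝔸 := .restrictScalars ℚ ℝ 𝔸
    rw [← NormedSpace.exp_nsmul]
    congr 1
    rw [← Nat.cast_smul_eq_nsmul ℝ, smul_smul]
    push_cast
    rw [hsdef, mul_inv_cancel₀ hn.ne', one_smul]
  rw [he]
  refine (norm_pow_sub_pow_le hx hy n).trans ?_
  gcongr
  rw [← Real.exp_nat_mul]
  apply Real.exp_le_exp.2
  rw [← mul_assoc]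
  refine mul_le_of_le_one_left (by positivity) ?_
  rw [hsdef, ← div_eq_mul_inv, div_le_one hn]
  linarith

end LieProduct

/-! ### Golden–Thompson inequality -/

section GoldenThompson

open scoped Matrix

variable {m : Type*} [Fintype m]

/-- Expand the squared Frobenius norm of `X - Yᵀ`, which is nonnegative. -/
theorem trace_mul_le_of_transpose (X Y : Matrix m m ℝ) :
    (X * Y).trace ≤ ((Xᵀ * X).trace + (Yᵀ * Y).trace) / 2 := by
  have h : 0 ≤ ((X - Yᵀ)ᵀ * (X - Yᵀ)).trace := by
    simpa using (Matrix.posSemidef_conjTranspose_mul_self (X - Yᵀ)).trace_nonneg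
  have e : ((X - Yᵀ)ᵀ * (X - Yᵀ)).trace
      = (Xᵀ * X).trace + (Yᵀ * Y).trace - 2 * (X * Y).trace := by
    have h1 : (Xᵀ * Yᵀ).trace = (X * Y).trace := by
      rw [← Matrix.transpose_mul, Matrix.trace_transpose, Matrix.trace_mul_comm]
    simp only [Matrix.transpose_sub, Matrix.transpose_transpose, sub_mul, mul_sub,
      Matrix.trace_sub, h1]
    rw [Matrix.trace_mul_comm Y X, Matrix.trace_mul_comm Y Yᵀ]
    ring
  linarith

variable [DecidableEq m]

theorem trace_mul_pow_comm (X Y : Matrix m m ℝ) (k : ℕ) :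
    ((X * Y) ^ k).trace = ((Y * X) ^ k).trace := by
  cases k with
  | zero => simp
  | succ k =>
    rw [pow_succ, ← mul_assoc, mul_pow_mul, mul_assoc, Matrix.trace_mul_comm, mul_assoc,
      ← pow_succ]

/-- The two claims feed each other. The first at `k`, applied to `M ^ 2` or to `P * Q`, gives after
cyclic rotation a product of two symmetric matrices, to which the second at `k` applies. -/
theorem trace_pow_two_pow_le_and_trace_mul_pow_le (k : ℕ) :
    (∀ M : Matrix m m ℝ, (M ^ 2 ^ (k + 1)).trace ≤ ((Mᵀ * M) ^ 2 ^ k).trace) ∧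
    (∀ P Q : Matrix m m ℝ, P.IsSymm → Q.IsSymm →
      ((P * Q) ^ 2 ^ k).trace ≤ (P ^ 2 ^ k * Q ^ 2 ^ k).trace) := by
  induction k with
  | zero =>
    refine ⟨fun M => ?_, fun P Q _ _ => by simp⟩
    have := trace_mul_le_of_transpose M M
    simpa [pow_two] using this
  | succ k ih =>
    obtain ⟨ihW, ihG⟩ := ih
    refine ⟨fun M => ?_, fun P Q hP hQ => ?_⟩
    · have hP : (Mᵀ * M).IsSymm := by simp [Matrix.IsSymm, Matrix.transpose_mul]
      have hQ : (M * Mᵀ).IsSymm := by simp [Matrix.IsSymm, Matrix.transpose_mul]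
      calc (M ^ 2 ^ (k + 1 + 1)).trace = ((M ^ 2) ^ 2 ^ (k + 1)).trace := by
            rw [← pow_mul, ← pow_succ']
        _ ≤ (((M ^ 2)ᵀ * M ^ 2) ^ 2 ^ k).trace := ihW _
        _ = ((Mᵀ * (Mᵀ * M * M)) ^ 2 ^ k).trace := by
            rw [pow_two, Matrix.transpose_mul]; simp only [mul_assoc]
        _ = ((Mᵀ * M * (M * Mᵀ)) ^ 2 ^ k).trace := by
            rw [trace_mul_pow_comm]; simp only [mul_assoc]
        _ ≤ ((Mᵀ * M) ^ 2 ^ k * (M * Mᵀ) ^ 2 ^ k).trace := ihG _ _ hP hQ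
        _ ≤ _ := trace_mul_le_of_transpose _ _
        _ = ((Mᵀ * M) ^ 2 ^ (k + 1)).trace := by
            rw [(hP.pow _).eq, (hQ.pow _).eq, ← pow_add, ← pow_add, ← two_mul, ← pow_succ',
              trace_mul_pow_comm M Mᵀ]
            ring
    · calc ((P * Q) ^ 2 ^ (k + 1)).trace ≤ (((P * Q)ᵀ * (P * Q)) ^ 2 ^ k).trace := ihW _
        _ = ((Q * (P ^ 2 * Q)) ^ 2 ^ k).trace := by
            rw [Matrix.transpose_mul, hP.eq, hQ.eq, pow_two]; simp only [mul_assoc]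
        _ = ((P ^ 2 * Q ^ 2) ^ 2 ^ k).trace := by
            rw [trace_mul_pow_comm, pow_two Q]; simp only [mul_assoc]
        _ ≤ ((P ^ 2) ^ 2 ^ k * (Q ^ 2) ^ 2 ^ k).trace := ihG _ _ (hP.pow 2) (hQ.pow 2)
        _ = _ := by rw [← pow_mul, ← pow_mul, ← pow_succ']

theorem trace_mul_pow_two_pow_le {P Q : Matrix m m ℝ} (hP : P.IsSymm) (hQ : Q.IsSymm) (k : ℕ) :
    ((P * Q) ^ 2 ^ k).trace ≤ (P ^ 2 ^ k * Q ^ 2 ^ k).trace :=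
  (trace_pow_two_pow_le_and_trace_mul_pow_le k).2 P Q hP hQ

theorem exp_inv_smul_pow (A : Matrix m m ℝ) (n : ℕ) :
    NormedSpace.exp (((n : ℝ) + 1)⁻¹ • A) ^ (n + 1) = NormedSpace.exp A := by
  rw [← Matrix.exp_nsmul]
  congr 1
  rw [← Nat.cast_smul_eq_nsmul ℝ, smul_smul]
  push_cast
  rw [mul_inv_cancel₀ (by positivity), one_smul]

/-- The **Golden–Thompson inequality** for real symmetric matrices. -/
theorem trace_exp_add_le {A B : Matrix m m ℝ} (hA : A.IsSymm) (hB : B.IsSymm) :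
    (NormedSpace.exp (A + B)).trace ≤ (NormedSpace.exp A * NormedSpace.exp B).trace := by
  rcases isEmpty_or_nonempty m with hm | hm
  · simp [Matrix.trace]
  have hlim : Tendsto (fun n : ℕ => (NormedSpace.exp (((n : ℝ) + 1)⁻¹ • A) *
      NormedSpace.exp (((n : ℝ) + 1)⁻¹ • B)) ^ (n + 1)) atTop
        (𝓝 (NormedSpace.exp (A + B))) := by
    let _ : NormedRing (Matrix m m ℝ) := Matrix.linftyOpNormedRing
    let _ : NormedAlgebra ℝ (Matrix m m ℝ) := Matrix.linftyOpNormedAlgebra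
    have _ : NormOneClass (Matrix m m ℝ) := Matrix.linfty_opNormOneClass
    exact tendsto_exp_mul_exp_pow A B
  -- The trace inequality is available only for powers of two, so the limit is taken along `n + 1 =
  -- 2 ^ k`.
  have hsub : Tendsto (fun k : ℕ => 2 ^ k - 1) atTop atTop := by
    refine tendsto_atTop_mono (fun k => ?_) tendsto_id
    exact Nat.le_sub_one_of_lt Nat.lt_two_pow_self
  have htr : Continuous (Matrix.trace : Matrix m m ℝ → ℝ) := continuous_id.matrix_trace
  refine le_of_tendsto ((htr.tendsto _).comp (hlim.comp hsub)) (Eventually.of_forall fun k => ?_)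
  have hk : 2 ^ k - 1 + 1 = 2 ^ k := Nat.sub_add_cancel Nat.one_le_two_pow
  have hsA := (hA.smul (((2 ^ k - 1 : ℕ) : ℝ) + 1)⁻¹).exp
  have hsB := (hB.smul (((2 ^ k - 1 : ℕ) : ℝ) + 1)⁻¹).exp
  have h := trace_mul_pow_two_pow_le hsA hsB k
  simp only [Function.comp_apply]
  generalize 2 ^ k - 1 = N at *
  rw [← hk, exp_inv_smul_pow, exp_inv_smul_pow] at h
  exact h

end GoldenThompson

/-! ### Spectral calculus for real symmetric matrices -/

section Spectral

open scoped Matrix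

variable {m : Type*} [Fintype m] [DecidableEq m]

theorem exists_orthogonal_diagonalization {A : Matrix m m ℝ} (hA : A.IsSymm) :
    ∃ (U : Matrix m m ℝ) (d : m → ℝ), U * Uᵀ = 1 ∧ Uᵀ * U = 1 ∧
      A = U * Matrix.diagonal d * Uᵀ := by
  have hA' : A.IsHermitian := by simpa [Matrix.IsHermitian] using hA.eq
  refine ⟨hA'.eigenvectorUnitary, hA'.eigenvalues, ?_, ?_, ?_⟩
  · have := Unitary.coe_mul_star_self hA'.eigenvectorUnitary
    simpa [Matrix.star_eq_conjTranspose] using this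
  · have := Unitary.coe_star_mul_self hA'.eigenvectorUnitary
    simpa [Matrix.star_eq_conjTranspose] using this
  · have := hA'.spectral_theorem
    rw [Unitary.conjStarAlgAut_apply] at this
    simpa [Matrix.star_eq_conjTranspose] using this

theorem exp_orthogonal_conj {U : Matrix m m ℝ} (hU : U * Uᵀ = 1) (d : m → ℝ) :
    NormedSpace.exp (U * Matrix.diagonal d * Uᵀ) =
      U * Matrix.diagonal (fun i => Real.exp (d i)) * Uᵀ := by
  have hi : U⁻¹ = Uᵀ := Matrix.inv_eq_right_inv hU
  have hu : IsUnit U := IsUnit.of_mul_eq_one _ hU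
  rw [← hi, Matrix.exp_conj _ _ hu, Matrix.exp_diagonal]
  congr 3
  ext i
  rw [Pi.coe_exp, Real.exp_eq_exp_ℝ]

theorem posSemidef_exp {A : Matrix m m ℝ} (hA : A.IsSymm) : (NormedSpace.exp A).PosSemidef := by
  obtain ⟨U, d, hU, -, rfl⟩ := exists_orthogonal_diagonalization hA
  rw [exp_orthogonal_conj hU]
  have h : (Matrix.diagonal (fun i => Real.exp (d i))).PosSemidef :=
    Matrix.PosSemidef.diagonal fun i => (Real.exp_pos _).le
  simpa using h.mul_mul_conjTranspose_same U

/-- If `f(x) = a exp(r x - g x²) + b exp(s x - g x²)` is at most `1` at the eigenvalues of `A`, here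
located by the equation `A³ = z² A`, then `tr (M f(A)) ≤ tr M` for positive semidefinite `M`. -/
theorem trace_mul_exp_add_le {A M : Matrix m m ℝ} (hA : A.IsSymm) (hM : M.PosSemidef) {z : ℝ}
    (hz : A * A * A = z ^ 2 • A) {a b r s g : ℝ}
    (h : ∀ x : ℝ, |x| ≤ |z| →
      a * Real.exp (r * x - g * x ^ 2) + b * Real.exp (s * x - g * x ^ 2) ≤ 1) :
    a * (M * NormedSpace.exp (r • A - g • (A * A))).trace +
      b * (M * NormedSpace.exp (s • A - g • (A * A))).trace ≤ M.trace := by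
  obtain ⟨U, d, hU, hU', rfl⟩ := exists_orthogonal_diagonalization hA
  have hmul (v w : m → ℝ) : U * Matrix.diagonal v * Uᵀ * (U * Matrix.diagonal w * Uᵀ) =
      U * Matrix.diagonal (fun i => v i * w i) * Uᵀ := by
    rw [← Matrix.diagonal_mul_diagonal]
    calc _ = U * Matrix.diagonal v * (Uᵀ * U) * Matrix.diagonal w * Uᵀ := by
          simp only [mul_assoc]
      _ = _ := by rw [hU', mul_one]; simp only [mul_assoc]
  have hsmul (c : ℝ) (v : m → ℝ) : c • (U * Matrix.diagonal v * Uᵀ) =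
      U * Matrix.diagonal (fun i => c * v i) * Uᵀ := by
    rw [← smul_mul_assoc, ← mul_smul_comm, ← Matrix.diagonal_smul]; rfl
  have hsub (v w : m → ℝ) : U * Matrix.diagonal v * Uᵀ - U * Matrix.diagonal w * Uᵀ =
      U * Matrix.diagonal (fun i => v i - w i) * Uᵀ := by
    rw [← Matrix.diagonal_sub, mul_sub, sub_mul]
  have hd (i : m) : |d i| ≤ |z| := by
    rw [hmul, hmul, hsmul] at hz
    have h1 : Matrix.diagonal (fun i => d i * d i * d i) =
        Matrix.diagonal (fun i => z ^ 2 * d i) := by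
      have := congrArg (fun X => Uᵀ * X * U) hz
      simp only [mul_assoc, hU', mul_one] at this
      simpa only [← mul_assoc, hU', one_mul] using this
    have h2 := congrFun (Matrix.diagonal_injective h1) i
    rcases eq_or_ne (d i) 0 with h0 | h0
    · simp [h0]
    · have h3 : d i * d i = z ^ 2 := mul_right_cancel₀ h0 h2
      exact (sq_eq_sq_iff_abs_eq_abs _ _).1 (by rw [← h3, sq]) |>.le
  have htr (v : m → ℝ) : (M * (U * Matrix.diagonal v * Uᵀ)).trace =
      ∑ i, (Uᵀ * M * U) i i * v i := by
    rw [← mul_assoc, Matrix.trace_mul_comm, ← mul_assoc, ← mul_assoc]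
    simp [Matrix.trace, Matrix.mul_diagonal]
  have hone : M.trace = ∑ i, (Uᵀ * M * U) i i := by
    have := htr 1
    simpa [hU] using this
  have hpos (i : m) : 0 ≤ (Uᵀ * M * U) i i := by
    have := (hM.conjTranspose_mul_mul_same U).diag_nonneg (i := i)
    simpa using this
  rw [hmul, hsmul, hsmul, hsmul, hsub, hsub, exp_orthogonal_conj hU, exp_orthogonal_conj hU, htr,
    htr, hone, Finset.mul_sum, Finset.mul_sum, ← Finset.sum_add_distrib]
  refine Finset.sum_le_sum fun i _ => ?_
  have := mul_le_mul_of_nonneg_left (h (d i) (hd i)) (hpos i)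
  rw [sq] at this
  linarith

/-- Each `exp` of an eigenvalue is at most the sum of all of them, so every eigenvalue is at most
`t`. -/
theorem dotProduct_mulVec_le_of_trace_exp_le {Y : Matrix m m ℝ} (hY : Y.IsSymm) {t : ℝ}
    (h : (NormedSpace.exp Y).trace ≤ Real.exp t) (x : m → ℝ) :
    x ⬝ᵥ (Y *ᵥ x) ≤ t * (x ⬝ᵥ x) := by
  obtain ⟨U, d, hU, hU', rfl⟩ := exists_orthogonal_diagonalization hY
  have hd (i : m) : d i ≤ t := by
    rw [exp_orthogonal_conj hU, Matrix.trace_mul_comm, ← mul_assoc, hU', one_mul,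
      Matrix.trace_diagonal] at h
    exact Real.exp_le_exp.1 ((Finset.single_le_sum (f := fun i => Real.exp (d i))
      (fun j _ => (Real.exp_pos _).le) (Finset.mem_univ i)).trans h)
  have hx : x ⬝ᵥ x = (Uᵀ *ᵥ x) ⬝ᵥ (Uᵀ *ᵥ x) := by
    rw [Matrix.dotProduct_mulVec, Matrix.vecMul_transpose, Matrix.mulVec_mulVec, hU,
      Matrix.one_mulVec]
  have hy : x ⬝ᵥ ((U * Matrix.diagonal d * Uᵀ) *ᵥ x) =
      (Uᵀ *ᵥ x) ⬝ᵥ (Matrix.diagonal d *ᵥ (Uᵀ *ᵥ x)) := by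
    rw [← Matrix.mulVec_mulVec, ← Matrix.mulVec_mulVec, Matrix.dotProduct_mulVec x U,
      ← Matrix.mulVec_transpose]
  rw [hx, hy]
  generalize Uᵀ *ᵥ x = v
  simp only [dotProduct, Matrix.mulVec_diagonal, Finset.mul_sum]
  refine Finset.sum_le_sum fun i _ => ?_
  nlinarith [hd i, mul_self_nonneg (v i)]

end Spectral

/-! ### Exponential trace moments of independent sums -/

section TraceSupermartingale

variable {m : Type*} [Fintype m] [DecidableEq m] {ι : Type*} [Finite ι]
  {E : Type*} [MeasurableSpace E] {P : Measure E}

theorem integrable_comp_of_finite {α : Type*} [Finite α] [MeasurableSpace α]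
    [MeasurableSingletonClass α] [IsFiniteMeasure P] {X : E → α} (hX : Measurable X) (F : α → ℝ) :
    Integrable (fun ω => F (X ω)) P :=
  (Integrable.of_finite (μ := P.map X) (f := F)).comp_measurable hX

/-- Exponential trace moments of a sum of independent two-valued random symmetric matrices `B k`
are controlled by the initial matrix `D`, as soon as each `exp (B k)` has mean at most `1`. -/
theorem integral_trace_exp_add_sum_le [IsProbabilityMeasure P] {χ : ι → E → Fin 2}
    (hχ : ∀ k, Measurable (χ k)) (hind : iIndepFun χ P)
    {B : ι → Fin 2 → Matrix m m ℝ} (hB : ∀ k j, (B k j).IsSymm) {D : Matrix m m ℝ} (hD : D.IsSymm)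
    (hmean : ∀ k, ∀ M : Matrix m m ℝ, M.PosSemidef →
      ∑ j, P.real (χ k ⁻¹' {j}) * (M * NormedSpace.exp (B k j)).trace ≤ M.trace) (s : Finset ι) :
    ∫ ω, (NormedSpace.exp (D + ∑ k ∈ s, B k (χ k ω))).trace ∂P ≤ (NormedSpace.exp D).trace := by
  classical
  have hX : Measurable (fun ω k => χ k ω) := measurable_pi_lambda _ hχ
  induction s using Finset.induction_on with
  | empty => simp
  | insert k s hk ih =>
    refine le_trans ?_ ih
    have hsymm (ω : E) : (D + ∑ k ∈ s, B k (χ k ω)).IsSymm := by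
      refine hD.add ?_
      simp only [Matrix.IsSymm, Matrix.transpose_sum]
      exact Finset.sum_congr rfl fun k _ => hB k _
    -- Golden–Thompson splits off the new summand; the indicators of the values of `χ k` separate
    -- its randomness from that of the summands in `s`, so that independence can be used.
    have hstep (ω : E) : (NormedSpace.exp (D + ∑ k ∈ insert k s, B k (χ k ω))).trace ≤
        ∑ j, (if χ k ω = j then (1 : ℝ) else 0) *
          (NormedSpace.exp (D + ∑ k ∈ s, B k (χ k ω)) * NormedSpace.exp (B k j)).trace := by
      rw [Finset.sum_insert hk, add_comm (B k _), ← add_assoc]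
      simpa using trace_exp_add_le (hsymm ω) (hB k (χ k ω))
    have hint (j : Fin 2) : Integrable (fun ω =>
        (NormedSpace.exp (D + ∑ k ∈ s, B k (χ k ω)) * NormedSpace.exp (B k j)).trace) P :=
      integrable_comp_of_finite hX fun y =>
        (NormedSpace.exp (D + ∑ k ∈ s, B k (y k)) * NormedSpace.exp (B k j)).trace
    have hint' (j : Fin 2) : Integrable (fun ω => (if χ k ω = j then (1 : ℝ) else 0) *
        (NormedSpace.exp (D + ∑ k ∈ s, B k (χ k ω)) * NormedSpace.exp (B k j)).trace) P :=
      integrable_comp_of_finite hX fun y => (if y k = j then (1 : ℝ) else 0) *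
        (NormedSpace.exp (D + ∑ k ∈ s, B k (y k)) * NormedSpace.exp (B k j)).trace
    have hprod (j : Fin 2) : ∫ ω, (if χ k ω = j then (1 : ℝ) else 0) *
        (NormedSpace.exp (D + ∑ k ∈ s, B k (χ k ω)) * NormedSpace.exp (B k j)).trace ∂P =
        P.real (χ k ⁻¹' {j}) * ∫ ω,
          (NormedSpace.exp (D + ∑ k ∈ s, B k (χ k ω)) * NormedSpace.exp (B k j)).trace ∂P := by
      have hi := hind.indepFun_finset {k} s (by simpa using hk) hχ
      have := hi.integral_fun_comp_mul_comp
        (f := fun y => if y ⟨k, by simp⟩ = j then (1 : ℝ) else 0)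
        (g := fun y => (NormedSpace.exp (D + ∑ k : s, B k (y k)) * NormedSpace.exp (B k j)).trace)
        (measurable_pi_lambda _ fun i : ({k} : Finset ι) => hχ i).aemeasurable
        (measurable_pi_lambda _ fun i : s => hχ i).aemeasurable
        (Measurable.of_discrete).aestronglyMeasurable (Measurable.of_discrete).aestronglyMeasurable
      have hsum (ω : E) : ∑ k : s, B k (χ k ω) = ∑ k ∈ s, B k (χ k ω) :=
        Finset.sum_coe_sort s fun k => B k (χ k ω)
      simp only [hsum] at this
      rw [this]
      congr 1
      have : (fun ω => if χ k ω = j then (1 : ℝ) else 0) =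
          (χ k ⁻¹' {j}).indicator (fun _ => 1) := by
        ext ω; simp [Set.indicator]
      rw [this, integral_indicator_const _ (hχ k (measurableSet_singleton j))]
      simp
    calc _ ≤ ∫ ω, ∑ j, (if χ k ω = j then (1 : ℝ) else 0) *
          (NormedSpace.exp (D + ∑ k ∈ s, B k (χ k ω)) * NormedSpace.exp (B k j)).trace ∂P :=
          integral_mono (integrable_comp_of_finite hX fun y =>
            (NormedSpace.exp (D + ∑ k ∈ insert k s, B k (y k))).trace)
            (integrable_finsetSum _ fun j _ => hint' j) hstep
      _ = ∫ ω, ∑ j, P.real (χ k ⁻¹' {j}) *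
          (NormedSpace.exp (D + ∑ k ∈ s, B k (χ k ω)) * NormedSpace.exp (B k j)).trace ∂P := by
          rw [integral_finsetSum _ fun j _ => hint' j,
            integral_finsetSum _ fun j _ => (hint j).const_mul _]
          simp only [hprod, integral_const_mul]
      _ ≤ _ := integral_mono (integrable_finsetSum _ fun j _ => (hint j).const_mul _)
          (integrable_comp_of_finite hX fun y => (NormedSpace.exp (D + ∑ k ∈ s, B k (y k))).trace)
          fun ω => hmean k _ (posSemidef_exp (hsymm ω))

end TraceSupermartingale

/-! ### Symmetric dilation -/

section Dilation

open scoped Matrix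

variable {n : ℕ}

/-- The symmetric matrix with off-diagonal blocks `M` and `Mᵀ`. -/
def dilation : Matrix (Fin n) (Fin n) ℝ →ₗ[ℝ] Matrix (Fin n ⊕ Fin n) (Fin n ⊕ Fin n) ℝ where
  toFun M := Matrix.fromBlocks 0 M Mᵀ 0
  map_add' M N := by simp [Matrix.fromBlocks_add]
  map_smul' c M := by simp [Matrix.fromBlocks_smul]

theorem dilation_apply (M : Matrix (Fin n) (Fin n) ℝ) :
    dilation M = Matrix.fromBlocks 0 M Mᵀ 0 := rfl

theorem dilation_isSymm (M : Matrix (Fin n) (Fin n) ℝ) : (dilation M).IsSymm := by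
  simp [Matrix.IsSymm, dilation_apply, Matrix.fromBlocks_transpose]

theorem dilation_mul_dilation (M N : Matrix (Fin n) (Fin n) ℝ) :
    dilation M * dilation N = Matrix.fromBlocks (M * Nᵀ) 0 0 (Mᵀ * N) := by
  simp [dilation_apply, Matrix.fromBlocks_multiply]

theorem dilation_single_mul_self (i j : Fin n) (z : ℝ) :
    dilation (Matrix.single i j z) * dilation (Matrix.single i j z) =
      Matrix.diagonal (Sum.elim (Pi.single i (z ^ 2)) (Pi.single j (z ^ 2))) := by
  rw [dilation_mul_dilation, ← Matrix.fromBlocks_diagonal]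
  simp [Matrix.transpose_single, Matrix.diagonal_single, sq]

/-- This confines the eigenvalues to `0` and `±z`, as `trace_mul_exp_add_le` requires. -/
theorem dilation_single_pow_three (i j : Fin n) (z : ℝ) :
    dilation (Matrix.single i j z) * dilation (Matrix.single i j z) *
      dilation (Matrix.single i j z) = z ^ 2 • dilation (Matrix.single i j z) := by
  rw [dilation_mul_dilation]
  simp [dilation_apply, Matrix.fromBlocks_multiply, Matrix.fromBlocks_smul,
    Matrix.transpose_single, sq, mul_assoc]

theorem sum_smul_dilation_single (c : Fin n × Fin n → ℝ) (Z : Matrix (Fin n) (Fin n) ℝ) :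
    ∑ k, c k • dilation (Matrix.single k.1 k.2 (Z k.1 k.2)) =
      dilation (Matrix.of fun i j => c (i, j) * Z i j) := by
  simp only [← map_smul, ← map_sum]
  congr 1
  rw [Matrix.matrix_eq_sum_single (Matrix.of fun i j => c (i, j) * Z i j), Fintype.sum_prod_type]
  simp [Matrix.smul_single]

theorem sum_dilation_single_mul_self (Z : Matrix (Fin n) (Fin n) ℝ) :
    ∑ k : Fin n × Fin n, dilation (Matrix.single k.1 k.2 (Z k.1 k.2)) *
        dilation (Matrix.single k.1 k.2 (Z k.1 k.2)) =
      Matrix.diagonal (Sum.elim (fun i => ∑ b, Z i b ^ 2) (fun j => ∑ a, Z a j ^ 2)) := by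
  simp only [dilation_single_mul_self]
  have h (f : Fin n × Fin n → Fin n ⊕ Fin n → ℝ) :
      ∑ k, Matrix.diagonal (f k) = Matrix.diagonal (∑ k, f k) :=
    (map_sum (Matrix.diagonalAddMonoidHom (Fin n ⊕ Fin n) ℝ) f Finset.univ).symm
  rw [h]
  congr 1
  ext (i | i)
  · simp [Finset.sum_apply, Fintype.sum_prod_type, Pi.single_apply]
  · simp [Finset.sum_apply, Fintype.sum_prod_type, Pi.single_apply]

theorem specNorm_le_of_dilation {M : Matrix (Fin n) (Fin n) ℝ} {t : ℝ} (ht : 0 ≤ t)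
    (h : ∀ x, x ⬝ᵥ (dilation M *ᵥ x) ≤ t * (x ⬝ᵥ x)) : specNorm M ≤ t := by
  refine ContinuousLinearMap.opNorm_le_bound _ ht fun v => ?_
  set u := Matrix.toEuclideanCLM (n := Fin n) (𝕜 := ℝ) M v with hu
  have huv : WithLp.ofLp u = M *ᵥ WithLp.ofLp v := by simp [hu]
  have hnorm (w : EuclideanSpace ℝ (Fin n)) : WithLp.ofLp w ⬝ᵥ WithLp.ofLp w = ‖w‖ ^ 2 := by
    rw [EuclideanSpace.real_norm_sq_eq]
    simp [dotProduct, sq]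
  -- The weights give both blocks the same norm: the form equals `2 ‖v‖ ‖u‖³` and the squared length
  -- is `2 ‖u‖² ‖v‖²`, whence `‖u‖ ≤ t ‖v‖`.
  have key := h (Sum.elim (‖v‖ • WithLp.ofLp u) (‖u‖ • WithLp.ofLp v))
  have e1 : M.transpose *ᵥ (‖v‖ • WithLp.ofLp u) ⬝ᵥ (‖u‖ • WithLp.ofLp v) =
      ‖v‖ * ‖u‖ * ‖u‖ ^ 2 := by
    rw [← hnorm u, Matrix.mulVec_transpose, ← Matrix.dotProduct_mulVec, Matrix.mulVec_smul, ← huv]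
    simp only [smul_dotProduct, dotProduct_smul, smul_eq_mul]
    ring
  rw [dilation_apply, Matrix.fromBlocks_mulVec, sumElim_dotProduct_sumElim,
    sumElim_dotProduct_sumElim] at key
  simp only [Sum.elim_comp_inl, Sum.elim_comp_inr, Matrix.zero_mulVec, zero_add, add_zero] at key
  rw [dotProduct_comm (‖u‖ • WithLp.ofLp v), e1, Matrix.mulVec_smul, ← huv] at key
  simp only [smul_dotProduct, dotProduct_smul, smul_eq_mul] at key
  rw [hnorm, hnorm] at key
  rcases (norm_nonneg u).eq_or_lt' with h0 | h0
  · rw [h0]; positivity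
  have hv : 0 < ‖v‖ := by
    rw [norm_pos_iff]
    rintro rfl
    simp [hu] at h0
  have : ‖u‖ * (‖u‖ ^ 2 * ‖v‖) ≤ t * ‖v‖ * (‖u‖ ^ 2 * ‖v‖) := by nlinarith
  exact le_of_mul_le_mul_right this (by positivity)

end Dilation

/-! ### Entrywise norms, the variance term and the scalar moment -/

section Norms

variable {n : ℕ} (Z : Matrix (Fin n) (Fin n) ℝ)

theorem abs_le_normInf (i j : Fin n) : |Z i j| ≤ normInf Z :=
  le_ciSup (f := fun ij : Fin n × Fin n => |Z ij.1 ij.2|) (Set.finite_range _).bddAbove (i, j)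

theorem normInf_nonneg : 0 ≤ normInf Z := Real.iSup_nonneg fun _ => abs_nonneg _

theorem normInfTwo_nonneg : 0 ≤ normInfTwo Z :=
  le_max_of_le_left (Real.iSup_nonneg fun _ => Real.sqrt_nonneg _)

theorem sum_row_sq_le (i : Fin n) : ∑ b, Z i b ^ 2 ≤ normInfTwo Z ^ 2 := by
  refine (Real.sqrt_le_left (normInfTwo_nonneg Z)).1 (le_max_of_le_left ?_)
  exact le_ciSup (f := fun i => √(∑ b, Z i b ^ 2)) (Set.finite_range _).bddAbove i

theorem sum_col_sq_le (j : Fin n) : ∑ a, Z a j ^ 2 ≤ normInfTwo Z ^ 2 := by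
  refine (Real.sqrt_le_left (normInfTwo_nonneg Z)).1 (le_max_of_le_right ?_)
  exact le_ciSup (f := fun j => √(∑ a, Z a j ^ 2)) (Set.finite_range _).bddAbove j

theorem normInf_le_normInfTwo [NeZero n] : normInf Z ≤ normInfTwo Z := by
  refine ciSup_le fun ij => abs_le_of_sq_le_sq (le_trans ?_ (sum_row_sq_le Z ij.1))
    (normInfTwo_nonneg Z)
  exact Finset.single_le_sum (f := fun b => Z ij.1 b ^ 2) (fun b _ => sq_nonneg _)
    (Finset.mem_univ ij.2)

end Norms

theorem trace_exp_smul_sum_dilation_le {n : ℕ} (Z : Matrix (Fin n) (Fin n) ℝ) {g : ℝ}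
    (hg : 0 ≤ g) :
    (NormedSpace.exp (g • ∑ k : Fin n × Fin n,
      dilation (Matrix.single k.1 k.2 (Z k.1 k.2)) *
        dilation (Matrix.single k.1 k.2 (Z k.1 k.2)))).trace ≤
      2 * n * Real.exp (g * normInfTwo Z ^ 2) := by
  rw [sum_dilation_single_mul_self, ← Matrix.diagonal_smul, Matrix.exp_diagonal,
    Matrix.trace_diagonal]
  simp only [Pi.coe_exp, ← Real.exp_eq_exp_ℝ, Fintype.sum_sum_type, Pi.smul_apply, Sum.elim_inl,
    Sum.elim_inr, smul_eq_mul]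
  have h1 : ∑ i, Real.exp (g * ∑ b, Z i b ^ 2) ≤ ∑ _i : Fin n, Real.exp (g * normInfTwo Z ^ 2) :=
    Finset.sum_le_sum fun i _ => Real.exp_le_exp.2 (by gcongr; exact sum_row_sq_le Z i)
  have h2 : ∑ j, Real.exp (g * ∑ a, Z a j ^ 2) ≤ ∑ _j : Fin n, Real.exp (g * normInfTwo Z ^ 2) :=
    Finset.sum_le_sum fun j _ => Real.exp_le_exp.2 (by gcongr; exact sum_col_sq_le Z j)
  simp only [Finset.sum_const, Finset.card_univ, Fintype.card_fin, nsmul_eq_mul] at h1 h2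
  linarith

/-- Put `y = θ x / p`, so `|y| ≤ 1` and `exp y ≤ 1 + y + y²`. Then `p exp y + (1 - p) ≤ 1 + (p y + p
y²) ≤ exp (p y + p y²)`, and the compensator together with the centering contributes exactly the
inverse of the right side. -/
theorem bernoulli_exp_moment_le {p θ x : ℝ} (hp : 0 < p) (hx : |θ * x| ≤ p) :
    p * Real.exp (θ * (1 / p - 1) * x - θ ^ 2 / p * x ^ 2) +
      (1 - p) * Real.exp (θ * (-1) * x - θ ^ 2 / p * x ^ 2) ≤ 1 := by
  set y := θ * x / p with hy
  have hpy : θ * x = p * y := by rw [hy]; field_simp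
  have hy1 : |y| ≤ 1 := by rw [hy, abs_div, abs_of_pos hp]; exact (div_le_one hp).2 hx
  have he : Real.exp y ≤ 1 + y + y ^ 2 := by
    have := (abs_le.1 (Real.abs_exp_sub_one_sub_id_le hy1)).2
    linarith
  have e0 : θ ^ 2 / p * x ^ 2 = p * y ^ 2 := by rw [hy]; field_simp
  have e1 : θ * (1 / p - 1) * x - θ ^ 2 / p * x ^ 2 = y + -(p * y + p * y ^ 2) := by
    rw [e0]
    have : θ * (1 / p - 1) * x = θ * x / p - θ * x := by ring
    rw [this, ← hy, hpy]; ring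
  have e2 : θ * (-1) * x - θ ^ 2 / p * x ^ 2 = -(p * y + p * y ^ 2) := by
    rw [e0]; linear_combination -hpy
  rw [e1, e2, Real.exp_add]
  have h1 : p * Real.exp y + (1 - p) ≤ Real.exp (p * y + p * y ^ 2) := by
    have := Real.add_one_le_exp (p * y + p * y ^ 2)
    nlinarith
  calc _ = (p * Real.exp y + (1 - p)) * Real.exp (-(p * y + p * y ^ 2)) := by ring
    _ ≤ Real.exp (p * y + p * y ^ 2) * Real.exp (-(p * y + p * y ^ 2)) := by gcongr
    _ = 1 := by rw [← Real.exp_add]; simp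

/-! ### Bernstein tail bound -/

section Tail

variable {E : Type*} [MeasurableSpace E] {P : Measure E} [IsProbabilityMeasure P] {n : ℕ}

/-- A Bernstein-type tail bound for the sampling error, with a free parameter `θ`. -/
theorem IsBernoulliSampling.prob_lt_specNorm_le {p θ t : ℝ} {Ω : E → Set (Fin n × Fin n)}
    (hΩ : IsBernoulliSampling P p Ω) (Z : Matrix (Fin n) (Fin n) ℝ) (hp : 0 < p) (hθ : 0 < θ)
    (hθZ : θ * normInf Z ≤ p) (ht : 0 ≤ t) :
    P.real {ω | t < specNorm (rescaledProjOn p (Ω ω) Z - Z)} ≤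
      2 * n * Real.exp (θ ^ 2 / p * normInfTwo Z ^ 2 - θ * t) := by
  classical
  set χ : Fin n × Fin n → E → Fin 2 :=
    fun k => {ω | k ∈ Ω ω}.indicator fun _ => (1 : Fin 2) with hχdef
  have hχ (k) : Measurable (χ k) := measurable_const.indicator (hΩ.measurableSet_mem k)
  have hind : iIndepFun χ P := hΩ.indep.iIndepFun_indicator
  have hχ1 (k) : P.real (χ k ⁻¹' {1}) = p := by
    rw [← hΩ.prob_mem k]
    congr 1
    ext ω
    by_cases h : k ∈ Ω ω <;> simp [hχdef, h]
  have hχ0 (k) : P.real (χ k ⁻¹' {0}) = 1 - p := by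
    rw [← hΩ.prob_mem k, ← probReal_compl_eq_one_sub (hΩ.measurableSet_mem k)]
    congr 1
    ext ω
    by_cases h : k ∈ Ω ω <;> simp [hχdef, h]
  let ξ : Fin 2 → ℝ := ![-1, 1 / p - 1]
  let A : Fin n × Fin n → Matrix (Fin n ⊕ Fin n) (Fin n ⊕ Fin n) ℝ :=
    fun k => dilation (Matrix.single k.1 k.2 (Z k.1 k.2))
  have hA (k) : (A k).IsSymm := dilation_isSymm _
  have hAA (k) : (A k * A k).IsSymm := by
    rw [Matrix.IsSymm, Matrix.transpose_mul, (hA k).eq]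
  set g := θ ^ 2 / p
  let B : Fin n × Fin n → Fin 2 → Matrix (Fin n ⊕ Fin n) (Fin n ⊕ Fin n) ℝ :=
    fun k j => (θ * ξ j) • A k - g • (A k * A k)
  have hB (k j) : (B k j).IsSymm := ((hA k).smul _).sub ((hAA k).smul _)
  have hD : (g • ∑ k, A k * A k).IsSymm := by
    refine Matrix.IsSymm.smul ?_ g
    simp only [Matrix.IsSymm, Matrix.transpose_sum]
    exact Finset.sum_congr rfl fun k _ => hAA k
  have hmean (k) (M : Matrix (Fin n ⊕ Fin n) (Fin n ⊕ Fin n) ℝ) (hM : M.PosSemidef) :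
      ∑ j, P.real (χ k ⁻¹' {j}) * (M * NormedSpace.exp (B k j)).trace ≤ M.trace := by
    rw [Fin.sum_univ_two, hχ0, hχ1, add_comm]
    refine trace_mul_exp_add_le (hA k) hM (dilation_single_pow_three _ _ _) fun x hx => ?_
    refine bernoulli_exp_moment_le hp ?_
    rw [abs_mul, abs_of_pos hθ]
    exact (mul_le_mul_of_nonneg_left (hx.trans (abs_le_normInf Z _ _)) hθ.le).trans hθZ
  -- The initial matrix cancels all compensators, leaving the dilated error.
  have hsum (ω : E) : g • ∑ k, A k * A k + ∑ k, B k (χ k ω) =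
      θ • dilation (rescaledProjOn p (Ω ω) Z - Z) := by
    rw [Finset.sum_sub_distrib, Finset.smul_sum, add_sub_cancel, ← map_smul,
      sum_smul_dilation_single]
    congr 1
    ext i j
    by_cases h : (i, j) ∈ Ω ω
    · simp [rescaledProjOn, projOn, hχdef, h, ξ]
      ring
    · simp [rescaledProjOn, projOn, hχdef, h, ξ]
  have hexp : ∫ ω, (NormedSpace.exp (θ • dilation (rescaledProjOn p (Ω ω) Z - Z))).trace ∂P ≤
      2 * n * Real.exp (g * normInfTwo Z ^ 2) := by
    have := integral_trace_exp_add_sum_le hχ hind hB hD hmean Finset.univ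
    simp only [hsum] at this
    exact this.trans (trace_exp_smul_sum_dilation_le Z (by positivity))
  have hint : Integrable (fun ω =>
      (NormedSpace.exp (θ • dilation (rescaledProjOn p (Ω ω) Z - Z))).trace) P := by
    have := integrable_comp_of_finite (P := P) (measurable_pi_lambda (fun ω k => χ k ω) hχ)
      fun y => (NormedSpace.exp (g • ∑ k, A k * A k + ∑ k, B k (y k))).trace
    simpa only [hsum] using this
  have hsub : {ω | t < specNorm (rescaledProjOn p (Ω ω) Z - Z)} ⊆ {ω | Real.exp (θ * t) ≤
      (NormedSpace.exp (θ • dilation (rescaledProjOn p (Ω ω) Z - Z))).trace} := by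
    intro ω hω
    by_contra hlt
    refine absurd (specNorm_le_of_dilation ht fun x => ?_) (not_le.2 hω)
    have := dotProduct_mulVec_le_of_trace_exp_le ((dilation_isSymm _).smul θ) (not_le.1 hlt).le x
    rw [Matrix.smul_mulVec, dotProduct_smul, smul_eq_mul, mul_assoc] at this
    exact le_of_mul_le_mul_left this hθ
  have hmarkov := mul_meas_ge_le_integral_of_nonneg (μ := P)
    (Eventually.of_forall fun ω =>
      (posSemidef_exp ((dilation_isSymm (rescaledProjOn p (Ω ω) Z - Z)).smul θ)).trace_nonneg)
    hint (Real.exp (θ * t))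
  rw [Real.exp_sub, mul_div_assoc', le_div_iff₀ (Real.exp_pos _), mul_comm]
  refine le_trans ?_ (hmarkov.trans hexp)
  exact mul_le_mul_of_nonneg_left (measureReal_mono hsub) (Real.exp_pos _).le

end Tail

/-! ### Choice of the parameter and the final bound -/

theorem exists_exp_parameter {p ℓ L σ : ℝ} (hp : 0 < p) (hℓ : 0 < ℓ) (hL : 0 < L) (hσ : 0 < σ) :
    ∃ θ : ℝ, 0 < θ ∧ θ * L ≤ p ∧ θ ^ 2 / p * σ ^ 2 ≤ ℓ ∧
      ℓ ≤ θ * (ℓ / p * L + √(ℓ / p) * σ) := by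
  have hs : 0 < √(p * ℓ) := Real.sqrt_pos.2 (by positivity)
  -- The largest `θ` that meets both upper constraints; whichever one is active, the matching term
  -- of the final bound alone already yields `ℓ`.
  refine ⟨min (p / L) (√(p * ℓ) / σ), by positivity, ?_, ?_, ?_⟩
  · exact (le_div_iff₀ hL).1 (min_le_left _ _)
  · have h1 : min (p / L) (√(p * ℓ) / σ) * σ ≤ √(p * ℓ) := (le_div_iff₀ hσ).1 (min_le_right _ _)
    have h2 : (min (p / L) (√(p * ℓ) / σ) * σ) ^ 2 ≤ p * ℓ := by
      refine (pow_le_pow_left₀ (by positivity) h1 2).trans_eq (Real.sq_sqrt (by positivity))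
    rw [div_mul_eq_mul_div, div_le_iff₀ hp]
    linarith [mul_pow (min (p / L) (√(p * ℓ) / σ)) σ 2]
  · have hr : 0 ≤ √(ℓ / p) := Real.sqrt_nonneg _
    rcases min_choice (p / L) (√(p * ℓ) / σ) with h | h <;> rw [h, mul_add]
    · have e : p / L * (ℓ / p * L) = ℓ := by field_simp
      rw [e]
      have : 0 ≤ p / L * (√(ℓ / p) * σ) := by positivity
      linarith
    · have e : √(p * ℓ) / σ * (√(ℓ / p) * σ) = ℓ := by
        have e' : √(p * ℓ) * √(ℓ / p) = ℓ := by
          rw [← Real.sqrt_mul (by positivity), show p * ℓ * (ℓ / p) = ℓ ^ 2 by field_simp,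
            Real.sqrt_sq hℓ.le]
        calc _ = √(p * ℓ) * √(ℓ / p) := by field_simp
          _ = ℓ := e'
      rw [e]
      have : 0 ≤ √(p * ℓ) / σ * (ℓ / p * L) := by positivity
      linarith

end MatrixSampling

theorem mainTheorem5 :
    ∀ c₂ : ℝ, 0 < c₂ → ∃ c : ℝ, 1 < c ∧ ∃ c₁ : ℝ, 0 < c₁ ∧
      ∀ (n : ℕ), 1 ≤ n → ∀ (p : ℝ), 0 < p → p ≤ 1 →
      ∀ (Z : Matrix (Fin n) (Fin n) ℝ)
        (E : Type*) [MeasurableSpace E] (P : Measure E) [IsProbabilityMeasure P]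
        (Ω : E → Set (Fin n × Fin n)), MatrixSampling.IsBernoulliSampling P p Ω →
        1 - c₁ * (n : ℝ) ^ (-c₂) ≤
          P.real {ω | MatrixSampling.specNorm (MatrixSampling.rescaledProjOn p (Ω ω) Z - Z) ≤
            c * (Real.log n / p * MatrixSampling.normInf Z +
              √(Real.log n / p) * MatrixSampling.normInfTwo Z)} := by
  intro c₂ hc₂
  -- With `ℓ = log n`, the tail exponent is at most `ℓ - (c₂ + 2) ℓ`: one `ℓ` pays for the variance
  -- term and another for the dimension factor `n`, leaving `2 n ^ (-c₂)`.
  refine ⟨c₂ + 2, by linarith, 2, two_pos, fun n hn p hp _ Z E _ P _ Ω hΩ => ?_⟩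
  have : NeZero n := ⟨by omega⟩
  -- For `n = 1` the logarithm vanishes, but the claimed probability `1 - 2` is negative.
  rcases hn.eq_or_lt with rfl | hn
  · refine le_trans ?_ measureReal_nonneg
    norm_num
  have hℓ : 0 < Real.log n := Real.log_pos (by exact_mod_cast hn)
  rcases (MatrixSampling.normInf_nonneg Z).eq_or_lt' with hL | hL
  · have hZ : Z = 0 := by
      ext i j
      simpa [hL] using MatrixSampling.abs_le_normInf Z i j
    have hW (ω : E) : MatrixSampling.rescaledProjOn p (Ω ω) Z - Z = 0 := by
      ext i j
      simp [MatrixSampling.rescaledProjOn, MatrixSampling.projOn, hZ]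
    have hc : 0 ≤ (c₂ + 2) * (Real.log n / p * MatrixSampling.normInf Z +
        √(Real.log n / p) * MatrixSampling.normInfTwo Z) := by
      have := MatrixSampling.normInfTwo_nonneg Z
      rw [hL]
      positivity
    have hu : {ω | MatrixSampling.specNorm (MatrixSampling.rescaledProjOn p (Ω ω) Z - Z) ≤
        (c₂ + 2) * (Real.log n / p * MatrixSampling.normInf Z +
          √(Real.log n / p) * MatrixSampling.normInfTwo Z)} = Set.univ := by
      ext ω
      simpa [hW, MatrixSampling.specNorm] using hc
    rw [hu, probReal_univ]
    have : (0 : ℝ) ≤ (n : ℝ) ^ (-c₂) := by positivity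
    linarith
  have hσ := hL.trans_le (MatrixSampling.normInf_le_normInfTwo Z)
  obtain ⟨θ, hθ, hθL, hθσ, hθt⟩ := MatrixSampling.exists_exp_parameter hp hℓ hL hσ
  set r := Real.log n / p * MatrixSampling.normInf Z +
    √(Real.log n / p) * MatrixSampling.normInfTwo Z
  have hr0 : 0 ≤ (c₂ + 2) * r := by positivity
  have htail := hΩ.prob_lt_specNorm_le Z hp hθ hθL hr0
  have hbound : 2 * n * Real.exp (θ ^ 2 / p * MatrixSampling.normInfTwo Z ^ 2 -
      θ * ((c₂ + 2) * r)) ≤ 2 * (n : ℝ) ^ (-c₂) := by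
    have hn0 : (0 : ℝ) < n := by positivity
    have h1 : θ ^ 2 / p * MatrixSampling.normInfTwo Z ^ 2 - θ * ((c₂ + 2) * r) ≤
        Real.log n * (-c₂) - Real.log n := by
      nlinarith [mul_le_mul_of_nonneg_left hθt (by linarith : 0 ≤ c₂ + 2)]
    have h2 : Real.exp (Real.log n * (-c₂) - Real.log n) = (n : ℝ) ^ (-c₂) / n := by
      rw [Real.exp_sub, ← Real.rpow_def_of_pos hn0, Real.exp_log hn0]
    calc _ ≤ 2 * n * ((n : ℝ) ^ (-c₂) / n) := by
          rw [← h2]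
          gcongr
      _ = _ := by field_simp
  have hcover := measureReal_union_le (μ := P)
    {ω | MatrixSampling.specNorm (MatrixSampling.rescaledProjOn p (Ω ω) Z - Z) ≤ (c₂ + 2) * r}
    {ω | (c₂ + 2) * r < MatrixSampling.specNorm (MatrixSampling.rescaledProjOn p (Ω ω) Z - Z)}
  have huniv : {ω | MatrixSampling.specNorm (MatrixSampling.rescaledProjOn p (Ω ω) Z - Z) ≤
      (c₂ + 2) * r} ∪ {ω | (c₂ + 2) * r <
        MatrixSampling.specNorm (MatrixSampling.rescaledProjOn p (Ω ω) Z - Z)} = Set.univ := by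
    ext ω
    simpa using le_or_gt _ _
  rw [huniv, probReal_univ] at hcover
  linarith
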